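/- All graphs are finite, undirected, without loops or multiple edges. Let $P_7$ be the path on $7$ vertices and $C_4$ the cycle on $4$ vertices. A graph is $(P_7,C_4)$-free if it has no induced subgraph isomorphic to $P_7$ and none isomorphic to $C_4$. The class of $(P_7, C_4)$-free bipartite graphs is well-quasi-ordered by the induced subgraph relation (where $G\le H$ means that $G$ is isomorphic to an induced subgraph of $H$). That is, every infinite sequence $G_0, G_1, G_2, \ldots$ of $(P_7,C_4)$-free bipartite graphs has indices $i<j$ with $G_i \le G_j$; equivalently, the class contains no infinite strictly decreasing sequence and no infinite antichain. -/

import Mathlib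

universe u

open scoped SimpleGraph

/-- A finite graph: undirected, without loops or multiple edges. -/
structure FinGraph : Type (u + 1) where
  V : Type u
  [finite : Finite V]
  graph : SimpleGraph V

/-- `G ≤ H` means that `G` is isomorphic to an induced subgraph of `H`. -/
instance FinGraph.instPreorder : Preorder FinGraph.{u} where
  le G H := G.graph ⊴ H.graph
  le_refl G := SimpleGraph.IsIndContained.refl G.graph
  le_trans _ _ _ h₁ h₂ := h₁.trans h₂

/-- `G` contains no copy of `H` as an induced subgraph. -/
def FinGraph.IsFree {W : Type*} (G : FinGraph.{u}) (H : SimpleGraph W) : Prop :=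
  ¬ H ⊴ G.graph

/-- The class of `(P₇, C₄)`-free bipartite graphs. -/
def p7c4FreeBipartite : Set FinGraph.{u} :=
  {G | G.graph.IsBipartite ∧
    G.IsFree (SimpleGraph.pathGraph 7) ∧ G.IsFree (SimpleGraph.cycleGraph 4)}

/-! Paths in the class, induced or not, have bounded length; this bounds tree-depth, and Ding's
theorem then gives the well-quasi-order. For the length bound, pass to the subgraph induced on a
path. It is connected with no induced `P₇`, so its diameter is at most five, and it remains to bound
degrees. A vertex with many neighbours on the path starts four legs of length three
(`not_exists_four_disjoint_paths`). Two legs form a seven-vertex path, whose only chords not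
creating a `C₄` join the end of one leg to the middle of the other. Each pair needs such a chord,
giving a tournament on four legs; `C₄`-freeness forces out-degree at most one, but six arcs exceed
four. Ding's theorem is an induction on depth: deleting roots while recording adjacency to them in
labels lowers the depth, and Higman's lemma handles the lists of parts. -/

/-- `HasTreeDepthLE G n S` says that the subgraph of `G` induced on `S` has tree-depth at most `n`:
`S` splits into parts with no edges between them, each part having a root whose removal leaves a
graph of tree-depth at most `n - 1`. The map `c` sends each vertex to the root of its part. -/
def HasTreeDepthLE {V : Type u} (G : SimpleGraph V) : ℕ → Set V → Prop
  | 0, S => S = ∅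
  | n + 1, S => ∃ c : V → V, (∀ v ∈ S, c v ∈ S ∧ c (c v) = c v) ∧
      (∀ v ∈ S, ∀ w ∈ S, G.Adj v w → c v = c w) ∧
      ∀ r ∈ S, c r = r → HasTreeDepthLE G n ({v | v ∈ S ∧ c v = r} \ {r})

/-! ### Ding's theorem for labelled graphs -/

/-- A finite set of vertices of a graph whose vertices carry labels. -/
structure LabelledPart (α : Type) : Type (u + 1) where
  V : Type u
  [nonempty : Nonempty V]
  graph : SimpleGraph V
  label : V → α
  carrier : Set V
  finite : carrier.Finite

attribute [instance] LabelledPart.nonempty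

namespace LabelledPart

variable {α : Type}

/-- Label-preserving embedding of induced subgraphs. -/
def Embeds (X Y : LabelledPart.{u} α) : Prop :=
  ∃ f : X.V → Y.V, Set.MapsTo f X.carrier Y.carrier ∧ Set.InjOn f X.carrier ∧
    (∀ v ∈ X.carrier, Y.label (f v) = X.label v) ∧
    ∀ v ∈ X.carrier, ∀ w ∈ X.carrier, Y.graph.Adj (f v) (f w) ↔ X.graph.Adj v w

instance : IsPreorder (LabelledPart.{u} α) Embeds where
  refl X := ⟨id, fun _ h => h, fun _ _ _ _ h => h, fun _ _ => rfl, fun _ _ _ _ => Iff.rfl⟩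
  trans X Y Z := by
    rintro ⟨f, hf, fi, fl, fa⟩ ⟨g, hg, gi, gl, ga⟩
    exact ⟨g ∘ f, hg.comp hf, gi.comp fi hf, fun v hv => (gl _ (hf hv)).trans (fl v hv),
      fun v hv w hw => (ga _ (hf hv) _ (hf hw)).trans (fa v hv w hw)⟩

/-- The part `{v ∈ X | c v = r}` with its root `r` removed, where the label of each remaining vertex
records its adjacency to `r`. -/
def branch (X : LabelledPart.{u} α) (c : X.V → X.V) (r : X.V) : LabelledPart.{u} (α × Prop) where
  V := X.V
  graph := X.graph
  label v := (X.label v, X.graph.Adj r v)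
  carrier := {v | v ∈ X.carrier ∧ c v = r} \ {r}
  finite := X.finite.subset fun _ h => h.1.1

/-- A root with label `a` together with what remains of its part. -/
def RootedEmbeds (p q : α × LabelledPart.{u} (α × Prop)) : Prop :=
  p.1 = q.1 ∧ p.2.Embeds q.2

instance : IsPreorder (α × LabelledPart.{u} (α × Prop)) RootedEmbeds where
  refl p := ⟨rfl, refl_of Embeds p.2⟩
  trans _ _ _ h k := ⟨h.1.trans k.1, trans_of Embeds h.2 k.2⟩

/-- An embedding of rootless parts extends to the roots. -/
theorem exists_part_embedding {X Y : LabelledPart.{u} α} {c : X.V → X.V} {d : Y.V → Y.V}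
    {r : X.V} {s : Y.V} (hs : s ∈ Y.carrier ∧ d s = s)
    (h : RootedEmbeds (X.label r, X.branch c r) (Y.label s, Y.branch d s)) :
    ∃ f : X.V → Y.V,
      (∀ v ∈ X.carrier, c v = r → f v ∈ Y.carrier ∧ d (f v) = s ∧ Y.label (f v) = X.label v) ∧
      ∀ v ∈ X.carrier, c v = r → ∀ w ∈ X.carrier, c w = r →
        (f v = f w → v = w) ∧ (Y.graph.Adj (f v) (f w) ↔ X.graph.Adj v w) := by
  classical
  obtain ⟨hl, f, hf, fi, fl, fa⟩ := h
  change X.label r = Y.label s at hl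
  have key : ∀ v ∈ X.carrier, c v = r → v ≠ r →
      ((f v ∈ Y.carrier ∧ d (f v) = s) ∧ f v ≠ s) ∧ Y.label (f v) = X.label v ∧
        (Y.graph.Adj s (f v) ↔ X.graph.Adj r v) := by
    intro v hv hc hne
    have h1 : v ∈ (X.branch c r).carrier := ⟨⟨hv, hc⟩, hne⟩
    have h2 := fl v h1
    exact ⟨hf h1, congrArg Prod.fst h2, iff_of_eq (congrArg Prod.snd h2)⟩
  refine ⟨fun v => if v = r then s else f v, ?_, ?_⟩
  · intro v hv hc
    by_cases hne : v = r
    · subst hne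
      simpa using ⟨hs.1, hs.2, hl.symm⟩
    · have := key v hv hc hne
      simpa [hne] using ⟨this.1.1.1, this.1.1.2, this.2.1⟩
  · intro v hv hcv w hw hcw
    by_cases h1 : v = r <;> by_cases h2 : w = r
    · simp [h1, h2]
    · have := key w hw hcw h2
      subst h1
      simpa [h2] using ⟨fun h => absurd h.symm this.1.2, this.2.2⟩
    · have := key v hv hcv h1
      subst h2
      simp only [h1]
      exact ⟨fun h => absurd h this.1.2,
        (Y.graph.adj_comm _ _).trans (this.2.2.trans (X.graph.adj_comm _ _))⟩
    · have m1 : v ∈ (X.branch c r).carrier := ⟨⟨hv, hcv⟩, h1⟩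
      have m2 : w ∈ (X.branch c r).carrier := ⟨⟨hw, hcw⟩, h2⟩
      simp only [h1, h2]
      exact ⟨fun h => fi m1 m2 h, fa v m1 w m2⟩

/-- Embeddings of the parts into distinct parts combine to an embedding. -/
theorem embeds_of_roots {X Y : LabelledPart.{u} α} {c : X.V → X.V} {d : Y.V → Y.V}
    (hc : ∀ v ∈ X.carrier, c v ∈ X.carrier ∧ c (c v) = c v)
    (hca : ∀ v ∈ X.carrier, ∀ w ∈ X.carrier, X.graph.Adj v w → c v = c w)
    (hda : ∀ v ∈ Y.carrier, ∀ w ∈ Y.carrier, Y.graph.Adj v w → d v = d w)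
    (σ : X.V → Y.V) (hσi : Set.InjOn σ {r | r ∈ X.carrier ∧ c r = r})
    (hσ : ∀ r ∈ X.carrier, c r = r → (σ r ∈ Y.carrier ∧ d (σ r) = σ r) ∧
      RootedEmbeds (X.label r, X.branch c r) (Y.label (σ r), Y.branch d (σ r))) :
    X.Embeds Y := by
  have ex : ∀ r, ∃ f : X.V → Y.V, r ∈ X.carrier ∧ c r = r →
      (∀ v ∈ X.carrier, c v = r →
        f v ∈ Y.carrier ∧ d (f v) = σ r ∧ Y.label (f v) = X.label v) ∧
      ∀ v ∈ X.carrier, c v = r → ∀ w ∈ X.carrier, c w = r →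
        (f v = f w → v = w) ∧ (Y.graph.Adj (f v) (f w) ↔ X.graph.Adj v w) := by
    intro r
    by_cases hr : r ∈ X.carrier ∧ c r = r
    · obtain ⟨f, hf⟩ := exists_part_embedding (hσ r hr.1 hr.2).1 (hσ r hr.1 hr.2).2
      exact ⟨f, fun _ => hf⟩
    · exact ⟨fun _ => Classical.arbitrary _, fun h => absurd h hr⟩
  choose f hf using ex
  have h1 := fun v hv => (hf (c v) (hc v hv)).1 v hv rfl
  have h2 : ∀ v ∈ X.carrier, ∀ w ∈ X.carrier, c v = c w →
      (f (c v) v = f (c w) w → v = w) ∧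
        (Y.graph.Adj (f (c v) v) (f (c w) w) ↔ X.graph.Adj v w) := by
    intro v hv w hw h
    rw [← h]
    exact (hf (c v) (hc v hv)).2 v hv rfl w hw h.symm
  -- Injectivity of `σ` sends different parts to different parts, so no coincidence or edge arises
  -- between their images.
  have h3 : ∀ v ∈ X.carrier, ∀ w ∈ X.carrier, d (f (c v) v) = d (f (c w) w) → c v = c w := by
    intro v hv w hw h
    rw [(h1 v hv).2.1, (h1 w hw).2.1] at h
    exact hσi (hc v hv) (hc w hw) h
  refine ⟨fun v => f (c v) v, fun v hv => (h1 v hv).1, fun v hv w hw h => ?_,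
    fun v hv => (h1 v hv).2.2, fun v hv w hw => ⟨fun h => ?_, fun h => ?_⟩⟩
  · exact (h2 v hv w hw (h3 v hv w hw (congrArg d h))).1 h
  · exact (h2 v hv w hw (h3 v hv w hw (hda _ (h1 v hv).1 _ (h1 w hw).1 h))).2.1 h
  · exact (h2 v hv w hw (hca v hv w hw h)).2.2 h

end LabelledPart

/-- Turns the output of Higman's lemma into the injective matching of roots. -/
theorem List.SublistForall₂.exists_injOn {A B : Type*} [Nonempty B] {R : A → B → Prop}
    {l : List A} {m : List B} (h : List.SublistForall₂ R l m) (hl : l.Nodup) (hm : m.Nodup) :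
    ∃ σ : A → B, Set.InjOn σ {a | a ∈ l} ∧ ∀ a ∈ l, σ a ∈ m ∧ R a (σ a) := by
  classical
  induction h with
  | nil => exact ⟨fun _ => Classical.arbitrary B, by simp, by simp⟩
  | @cons a b l m hab _ ih =>
    rw [List.nodup_cons] at hl hm
    obtain ⟨σ, hi, hσ⟩ := ih hl.2 hm.2
    have hne : ∀ x ∈ l, x ≠ a := fun x hx h => hl.1 (h ▸ hx)
    have hnb : ∀ x ∈ l, σ x ≠ b := fun x hx h => hm.1 (h ▸ (hσ x hx).1)
    refine ⟨Function.update σ a b, ?_, ?_⟩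
    · intro x hx y hy h
      rcases List.mem_cons.1 hx with hxa | hx <;> rcases List.mem_cons.1 hy with hya | hy
      · rw [hxa, hya]
      · rw [hxa, Function.update_self, Function.update_of_ne (hne y hy)] at h
        exact absurd h.symm (hnb y hy)
      · rw [hya, Function.update_self, Function.update_of_ne (hne x hx)] at h
        exact absurd h (hnb x hx)
      · rw [Function.update_of_ne (hne y hy), Function.update_of_ne (hne x hx)] at h
        exact hi hx hy h
    · intro x hx
      rcases List.mem_cons.1 hx with rfl | hx
      · simpa using hab
      · rw [Function.update_of_ne (hne x hx)]
        exact ⟨List.mem_cons_of_mem _ (hσ x hx).1, (hσ x hx).2⟩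
  | cons_right _ ih =>
    obtain ⟨σ, hi, hσ⟩ := ih hl (List.nodup_cons.1 hm).2
    exact ⟨σ, hi, fun x hx => ⟨List.mem_cons_of_mem _ (hσ x hx).1, (hσ x hx).2⟩⟩

/-- **Ding's theorem**: finite labelled graphs of bounded tree-depth are well-quasi-ordered by
the labelled induced subgraph relation. -/
theorem LabelledPart.partiallyWellOrderedOn_hasTreeDepthLE (n : ℕ) : ∀ (α : Type) [Finite α],
    {X : LabelledPart.{u} α | HasTreeDepthLE X.graph n X.carrier}.PartiallyWellOrderedOn
      Embeds := by
  classical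
  induction n with
  | zero =>
    intro α _
    rw [Set.partiallyWellOrderedOn_iff_exists_lt]
    intro f hf
    refine ⟨0, 1, zero_lt_one, fun _ => Classical.arbitrary _, ?_⟩
    have : (f 0).carrier = ∅ := hf 0
    simp [this, Set.MapsTo]
  | succ n ih =>
    intro α _
    have hprod : {p : α × LabelledPart.{u} (α × Prop) |
        HasTreeDepthLE p.2.graph n p.2.carrier}.PartiallyWellOrderedOn RootedEmbeds := by
      rw [Set.partiallyWellOrderedOn_iff_exists_lt]
      intro f hf
      obtain ⟨g, hg⟩ := (ih (α × Prop)).exists_monotone_subseq (f := fun i => (f i).2) hf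
      obtain ⟨i, j, hij, h⟩ := Finite.wellQuasiOrdered (α := α) (· = ·) fun i => (f (g i)).1
      exact ⟨g i, g j, g.strictMono hij, h, hg i j hij.le⟩
    have higman := Set.PartiallyWellOrderedOn.partiallyWellOrderedOn_sublistForall₂ _ hprod
    rw [Set.partiallyWellOrderedOn_iff_exists_lt] at higman ⊢
    intro f hf
    choose c hc hca htd using hf
    have fin : ∀ i, {r | r ∈ (f i).carrier ∧ c i r = r}.Finite :=
      fun i => (f i).finite.subset fun _ h => h.1
    obtain ⟨i, j, hij, h⟩ := higman
      (fun i => (fin i).toFinset.toList.map fun r => ((f i).label r, (f i).branch (c i) r)) <| by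
        intro i p hp
        simp only [List.mem_map, Finset.mem_toList, Set.Finite.mem_toFinset] at hp
        obtain ⟨r, hr, rfl⟩ := hp
        exact htd i r hr.1 hr.2
    rw [List.sublistForall₂_map_left_iff, List.sublistForall₂_map_right_iff] at h
    obtain ⟨σ, hσi, hσ⟩ := h.exists_injOn (Finset.nodup_toList _) (Finset.nodup_toList _)
    simp only [Finset.mem_toList, Set.Finite.mem_toFinset] at hσi hσ
    exact ⟨i, j, hij, embeds_of_roots (hc i) (hca i) (hca j) σ hσi
      fun r hr hr' => hσ r ⟨hr, hr'⟩⟩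

/-! ### From bounded paths to bounded tree-depth -/

/-- The graph `G` with all edges leaving `S` removed. -/
def SimpleGraph.restrictTo {V : Type u} (G : SimpleGraph V) (S : Set V) : SimpleGraph V where
  Adj v w := v ∈ S ∧ w ∈ S ∧ G.Adj v w
  symm := ⟨fun _ _ h => ⟨h.2.1, h.1, h.2.2.symm⟩⟩
  loopless := ⟨fun _ h => G.loopless.irrefl _ h.2.2⟩

/-- A graph without long paths has bounded tree-depth. Each component has a root in `P`, and only
paths starting at a vertex of `P` need to be bounded. -/
theorem hasTreeDepthLE_of_path_length_le {V : Type u} (G : SimpleGraph V) (n : ℕ) :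
    ∀ (S : Set V) (P : V → Prop),
      (∀ v ∈ S, ∃ r ∈ S, P r ∧ (G.restrictTo S).Reachable v r) →
      (∀ r l, P r → (∀ v ∈ r :: l, v ∈ S) → (r :: l).Nodup → (r :: l).IsChain G.Adj →
        (r :: l).length ≤ n) →
      HasTreeDepthLE G n S := by
  classical
  induction n with
  | zero =>
    intro S P hS hl
    refine Set.eq_empty_of_forall_notMem fun v hv => ?_
    obtain ⟨r, hr, hP, -⟩ := hS v hv
    have := hl r [] hP (by simpa using hr) (by simp) (by simp)
    simp at this
  | succ n ih =>
    intro S P hS hl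
    let root : (G.restrictTo S).ConnectedComponent → V → Prop := fun C r =>
      r ∈ S ∧ P r ∧ (G.restrictTo S).connectedComponentMk r = C
    let c : V → V := fun v =>
      if h : ∃ r, root ((G.restrictTo S).connectedComponentMk v) r then h.choose else v
    have hroot : ∀ v ∈ S, root ((G.restrictTo S).connectedComponentMk v) (c v) := by
      intro v hv
      obtain ⟨r, hr, hP, hvr⟩ := hS v hv
      have h : ∃ r, root ((G.restrictTo S).connectedComponentMk v) r :=
        ⟨r, hr, hP, SimpleGraph.ConnectedComponent.sound hvr.symm⟩
      simp only [c, dif_pos h]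
      exact h.choose_spec
    have hcongr : ∀ v ∈ S, ∀ w ∈ S, (G.restrictTo S).connectedComponentMk v =
        (G.restrictTo S).connectedComponentMk w → c v = c w := by
      intro v hv w hw h
      have h1 : ∃ r, root ((G.restrictTo S).connectedComponentMk v) r := ⟨_, hroot v hv⟩
      have h2 : ∃ r, root ((G.restrictTo S).connectedComponentMk w) r := ⟨_, hroot w hw⟩
      simp only [c, dif_pos h1, dif_pos h2]
      congr 1
      rw [h]
    have hadj : ∀ v ∈ S, ∀ w ∈ S, G.Adj v w → c v = c w := fun v hv w hw h =>
      hcongr v hv w hw (SimpleGraph.ConnectedComponent.sound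
        (SimpleGraph.Adj.reachable (G := G.restrictTo S) ⟨hv, hw, h⟩))
    refine ⟨c, fun v hv => ⟨(hroot v hv).1, hcongr _ (hroot v hv).1 _ hv (hroot v hv).2.2⟩,
      hadj, fun r hr hcr => ?_⟩
    have hPr : P r := hcr ▸ (hroot r hr).2.1
    -- After deleting `r`, each component of its part contains a neighbour of `r`, and a path
    -- starting there extends by `r`, so the bound drops by one.
    refine ih _ (G.Adj r) ?_ ?_
    · rintro v ⟨⟨hv, hcv⟩, hvr⟩
      have hreach : (G.restrictTo S).Reachable v r := by
        have := (hroot v hv).2.2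
        rw [hcv] at this
        exact (SimpleGraph.ConnectedComponent.exact this).symm
      obtain ⟨p⟩ := hreach
      clear hPr
      induction p with
      | nil => exact absurd rfl hvr
      | @cons v w r h p ihp =>
        by_cases hwr : w = r
        · subst hwr
          exact ⟨v, ⟨⟨hv, hcv⟩, hvr⟩, h.2.2.symm, SimpleGraph.Reachable.refl _⟩
        · have hcw : c w = r := (hadj v hv w h.2.1 h.2.2).symm.trans hcv
          obtain ⟨x, hx, hrx, hwx⟩ := ihp hr hcr hwr h.2.1 hcw
          exact ⟨x, hx, hrx, (SimpleGraph.Adj.reachable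
            (G := G.restrictTo ({v | v ∈ S ∧ c v = r} \ {r}))
            ⟨⟨⟨hv, hcv⟩, hvr⟩, ⟨⟨h.2.1, hcw⟩, hwr⟩, h.2.2⟩).trans hwx⟩
    · intro w l hrw hmem hnd hch
      have := hl r (w :: l) hPr ?_ ?_ (List.isChain_cons_cons.2 ⟨hrw, hch⟩)
      · simpa using this
      · intro v hv
        rcases List.mem_cons.1 hv with rfl | hv
        · exact hr
        · exact (hmem v hv).1.1
      · exact List.nodup_cons.2 ⟨fun h => (hmem r h).2 rfl, hnd⟩

/-! ### Path lengths in the class -/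

namespace SimpleGraph

variable {V : Type u} {G : SimpleGraph V}

/-- Opposite vertices of a 4-cycle share a colour, so a nondegenerate one has no chords. -/
theorem eq_or_eq_of_cycle_four (col : G.Coloring (Fin 2)) (hC : ¬ cycleGraph 4 ⊴ G)
    {a b c d : V} (hab : G.Adj a b) (hbc : G.Adj b c) (hcd : G.Adj c d) (hda : G.Adj d a) :
    a = c ∨ b = d := by
  by_contra! h
  obtain ⟨hac, hbd⟩ := h
  have nac : ¬ G.Adj a c := fun h => by
    have := col.valid hab; have := col.valid hbc; have := col.valid h; omega
  have nbd : ¬ G.Adj b d := fun h => by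
    have := col.valid hcd; have := col.valid hbc; have := col.valid h; omega
  refine hC ⟨⟨⟨![a, b, c, d], ?_⟩, ?_⟩⟩
  · intro i j hij
    have := hab.ne; have := hbc.ne; have := hcd.ne; have := hda.ne
    fin_cases i <;> fin_cases j <;> simp_all
  · intro i j
    have := hab.symm; have := hbc.symm; have := hcd.symm; have := hda.symm
    have := G.adj_comm a c; have := G.adj_comm b d
    rw [cycleGraph_adj']
    change G.Adj (![a, b, c, d] i) (![a, b, c, d] j) ↔ _
    fin_cases i <;> fin_cases j <;>
      simp_all [show (-2 : Fin 4) = 2 from rfl, show (-3 : Fin 4) = 1 from rfl]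

theorem false_of_path_seven (col : G.Coloring (Fin 2)) (hP : ¬ pathGraph 7 ⊴ G)
    {a b c d e f g : V} (hab : G.Adj a b) (hbc : G.Adj b c) (hcd : G.Adj c d) (hde : G.Adj d e)
    (hef : G.Adj e f) (hfg : G.Adj f g) (had : ¬ G.Adj a d) (haf : ¬ G.Adj a f)
    (hbe : ¬ G.Adj b e) (hbg : ¬ G.Adj b g) (hcf : ¬ G.Adj c f) (hdg : ¬ G.Adj d g) : False := by
  have c1 := col.valid hab
  have c2 := col.valid hbc
  have c3 := col.valid hcd
  have c4 := col.valid hde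
  have c5 := col.valid hef
  have c6 := col.valid hfg
  have same : ∀ {x y}, col x = col y → ¬ G.Adj x y := fun h k => col.valid k h
  have nadj : ∀ i j : Fin 7, i.val + 1 < j.val →
      ¬ G.Adj (![a, b, c, d, e, f, g] i) (![a, b, c, d, e, f, g] j) := by
    intro i j hij
    fin_cases i <;> fin_cases j <;> first
      | (exfalso; revert hij; decide)
      | assumption
      | (apply same; simp; omega)
  have adj : ∀ i j : Fin 7, i.val + 1 = j.val →
      G.Adj (![a, b, c, d, e, f, g] i) (![a, b, c, d, e, f, g] j) := by
    intro i j hij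
    fin_cases i <;> fin_cases j <;> first
      | (exfalso; revert hij; decide)
      | assumption
  have iff : ∀ i j : Fin 7, G.Adj (![a, b, c, d, e, f, g] i) (![a, b, c, d, e, f, g] j) ↔
      i.val + 1 = j.val ∨ j.val + 1 = i.val := by
    intro i j
    constructor
    · intro h
      by_contra! hne
      rcases lt_trichotomy i.val j.val with hij | hij | hij
      · exact nadj i j (by omega) h
      · rw [Fin.ext hij] at h
        exact G.loopless.irrefl _ h
      · exact nadj j i (by omega) h.symm
    · rintro (h | h)
      · exact adj i j h
      · exact (adj j i h).symm
  refine hP ⟨⟨⟨![a, b, c, d, e, f, g], ?_⟩, ?_⟩⟩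
  -- Distinct vertices of `P₇` have distinct neighbourhoods, so injectivity follows from the
  -- adjacencies alone.
  · intro i j hij
    have key : ∀ k : Fin 7, (i.val + 1 = k.val ∨ k.val + 1 = i.val) ↔
        (j.val + 1 = k.val ∨ k.val + 1 = j.val) := by
      intro k
      rw [← iff, ← iff, hij]
    revert key
    clear hij
    revert i j
    decide
  · intro i j
    rw [pathGraph_adj]
    exact iff i j

/-- In a `(P₇, C₄)`-free bipartite graph no vertex is the end of four paths of length three that
are disjoint apart from it. -/
theorem not_exists_four_disjoint_paths (col : G.Coloring (Fin 2)) (hP : ¬ pathGraph 7 ⊴ G)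
    (hC : ¬ cycleGraph 4 ⊴ G) {v : V} (z y x : Fin 4 → V) (hz : z.Injective) (hy : y.Injective)
    (hx : x.Injective) (hvz : ∀ i, G.Adj v (z i)) (hzy : ∀ i, G.Adj (z i) (y i))
    (hyx : ∀ i, G.Adj (y i) (x i)) (hyv : ∀ i, y i ≠ v) (hxz : ∀ i, x i ≠ z i) : False := by
  have hxv : ∀ i, ¬ G.Adj (x i) v := fun i h =>
    (eq_or_eq_of_cycle_four col hC (hvz i) (hzy i) (hyx i) h).elim
      (fun h => hyv i h.symm) (fun h => hxz i h.symm)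
  have hyz : ∀ i j, i ≠ j → ¬ G.Adj (y i) (z j) := fun i j hij h =>
    (eq_or_eq_of_cycle_four col hC (hvz i) (hzy i) h (hvz j).symm).elim
      (fun h => hyv i h.symm) (fun h => hij (hz h))
  have tour : ∀ i j, i ≠ j → G.Adj (x i) (y j) ∨ G.Adj (x j) (y i) := by
    intro i j hij
    by_contra! h
    exact false_of_path_seven col hP (hyx i).symm (hzy i).symm (hvz i).symm (hvz j) (hzy j) (hyx j)
      (hxv i) h.1 (hyz i j hij) (fun k => h.2 k.symm) (fun k => hyz j i hij.symm k.symm)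
      (fun k => hxv j k.symm)
  have share : ∀ i j k l, i ≠ j → k ≠ l → G.Adj (x i) (y k) → G.Adj (x i) (y l) →
      G.Adj (x j) (y k) → G.Adj (x j) (y l) → False := fun i j k l hij hkl h1 h2 h3 h4 =>
    (eq_or_eq_of_cycle_four col hC h1 h3.symm h4 h2.symm).elim
      (fun h => hij (hx h)) (fun h => hkl (hy h))
  -- An arc between `j` and `k` would close a 4-cycle through `x i`.
  have out : ∀ i j k, i ≠ j → i ≠ k → j ≠ k → G.Adj (x i) (y j) → G.Adj (x i) (y k) → False := by
    intro i j k hij hik hjk h1 h2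
    rcases tour j k hjk with h | h
    · exact share i j j k hij hjk h1 h2 (hyx j).symm h
    · exact share i k j k hik hjk h1 h2 h (hyx k).symm
  have t01 := tour 0 1 (by decide)
  have t02 := tour 0 2 (by decide)
  have t03 := tour 0 3 (by decide)
  have t12 := tour 1 2 (by decide)
  have t13 := tour 1 3 (by decide)
  have t23 := tour 2 3 (by decide)
  have o0 := out 0 1 2 (by decide) (by decide) (by decide)
  have o0' := out 0 1 3 (by decide) (by decide) (by decide)
  have o0'' := out 0 2 3 (by decide) (by decide) (by decide)
  have o1 := out 1 0 2 (by decide) (by decide) (by decide)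
  have o1' := out 1 0 3 (by decide) (by decide) (by decide)
  have o1'' := out 1 2 3 (by decide) (by decide) (by decide)
  have o2 := out 2 0 1 (by decide) (by decide) (by decide)
  have o2' := out 2 0 3 (by decide) (by decide) (by decide)
  have o2'' := out 2 1 3 (by decide) (by decide) (by decide)
  have o3 := out 3 0 1 (by decide) (by decide) (by decide)
  have o3' := out 3 0 2 (by decide) (by decide) (by decide)
  have o3'' := out 3 1 2 (by decide) (by decide) (by decide)
  grind

/-- A connected graph without induced `P₇` has diameter at most five. -/
theorem Connected.dist_le_five (hG : G.Connected) (hP : ¬ pathGraph 7 ⊴ G) (u v : V) :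
    G.dist u v ≤ 5 := by
  by_contra! hd
  obtain ⟨w, hw⟩ := hG.exists_walk_length_eq_dist u v
  have hdist : ∀ i ≤ w.length, G.dist u (w.getVert i) = i := by
    intro i hi
    have h1 := dist_le (w.take i)
    have h2 := dist_le (w.drop i)
    have h3 := hG.dist_triangle (u := u) (v := w.getVert i) (w := v)
    simp only [Walk.take_length, Walk.drop_length] at h1 h2
    omega
  refine hP ⟨⟨⟨fun i : Fin 7 => w.getVert i, ?_⟩, ?_⟩⟩
  · intro i j hij
    have h := congrArg (G.dist u) hij
    simp only at h
    rw [hdist i (by omega), hdist j (by omega)] at h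
    exact Fin.ext h
  · intro i j
    rw [pathGraph_adj]
    constructor
    · intro h
      change G.Adj (w.getVert i) (w.getVert j) at h
      have h1 := Adj.diff_dist_adj (u := u) h
      have h2 := h.ne
      rw [hdist i (by omega), hdist j (by omega)] at h1
      have : i.val ≠ j.val := fun h => h2 (by rw [h])
      omega
    · rintro (h | h)
      · have := w.adj_getVert_succ (i := i.val) (by omega)
        rwa [h] at this
      · have := w.adj_getVert_succ (i := j.val) (by omega)
        rw [h] at this
        exact this.symm

/-- Closed neighbourhoods of a ball's vertices cover the ball of radius one larger. -/
theorem Connected.card_le_pow [Fintype V] [DecidableRel G.Adj] (hG : G.Connected) {D k : ℕ}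
    (hD : ∀ v, G.degree v ≤ D) (hk : ∀ u v, G.dist u v ≤ k) : Fintype.card V ≤ (D + 1) ^ k := by
  classical
  obtain ⟨u⟩ := hG.nonempty
  have ball : ∀ k, (Finset.univ.filter fun v => G.dist u v ≤ k).card ≤ (D + 1) ^ k := by
    intro k
    induction k with
    | zero =>
      have : (Finset.univ.filter fun v => G.dist u v ≤ 0) ⊆ {u} := by
        intro v hv
        simp only [Finset.mem_filter, Finset.mem_univ, true_and, nonpos_iff_eq_zero,
          hG.dist_eq_zero_iff] at hv
        simp [hv]
      simpa using Finset.card_le_card this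
    | succ k ih =>
      have sub : (Finset.univ.filter fun v => G.dist u v ≤ k + 1) ⊆
          (Finset.univ.filter fun v => G.dist u v ≤ k).biUnion
            fun w => insert w (G.neighborFinset w) := by
        intro v hv
        simp only [Finset.mem_filter, Finset.mem_univ, true_and] at hv
        simp only [Finset.mem_biUnion, Finset.mem_filter, Finset.mem_univ, true_and,
          Finset.mem_insert, mem_neighborFinset]
        rcases Nat.le_succ_iff.1 hv with h | h
        · exact ⟨v, h, Or.inl rfl⟩
        · obtain ⟨w, hw⟩ := hG.exists_walk_length_eq_dist u v
          refine ⟨w.getVert k, (dist_le (w.take k)).trans (by simp), Or.inr ?_⟩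
          have := w.adj_getVert_succ (i := k) (by omega)
          rwa [w.getVert_of_length_le (by omega : w.length ≤ k + 1)] at this
      calc _ ≤ _ := Finset.card_le_card sub
        _ ≤ (Finset.univ.filter fun v => G.dist u v ≤ k).card * (D + 1) := by
          refine Finset.card_biUnion_le_card_mul _ _ _ fun w _ => ?_
          exact (Finset.card_insert_le _ _).trans (Nat.succ_le_succ (hD w))
        _ ≤ _ := by rw [pow_succ]; exact Nat.mul_le_mul_right _ ih
  have := ball k
  rwa [Finset.filter_true_of_mem fun v _ => hk u v] at this

/-- A `(P₇, C₄)`-free bipartite graph with a Hamiltonian path has bounded size. -/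
theorem card_le_of_hamiltonian_path {N : ℕ} {G : SimpleGraph (Fin N)} (col : G.Coloring (Fin 2))
    (hP : ¬ pathGraph 7 ⊴ G) (hC : ¬ cycleGraph 4 ⊴ G)
    (hG : ∀ i j : Fin N, i.val + 1 = j.val → G.Adj i j) : N ≤ 7 ^ 5 := by
  classical
  rcases Nat.eq_zero_or_pos N with rfl | hN
  · exact Nat.zero_le _
  have reach : ∀ (k : ℕ) (hk : k < N), G.Reachable ⟨0, hN⟩ ⟨k, hk⟩ := by
    intro k
    induction k with
    | zero => exact fun _ => Reachable.refl _
    | succ k ih => exact fun hk => (ih (by omega)).trans (hG ⟨k, by omega⟩ ⟨k + 1, hk⟩ rfl).reachable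
  have conn : G.Connected :=
    { preconnected := fun i j => (reach i i.2).symm.trans (reach j j.2)
      nonempty := ⟨⟨0, hN⟩⟩ }
  have deg : ∀ v, G.degree v ≤ 6 := by
    intro v
    by_contra! hdeg
    -- The last two vertices lack two successors, and the successor of `v - 1` is `v`. Seven
    -- neighbours minus three leave four.
    let bad : Finset (Fin N) :=
      Finset.univ.filter fun i => i.val ∈ ({N - 1, N - 2, v.val - 1} : Finset ℕ)
    have hbad : bad.card ≤ 3 := by
      refine (Finset.card_le_card_of_injOn (t := {N - 1, N - 2, v.val - 1}) Fin.val ?_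
        Fin.val_injective.injOn).trans Finset.card_le_three
      intro i hi
      exact (Finset.mem_filter.1 hi).2
    have hcard : 4 ≤ (G.neighborFinset v \ bad).card := by
      have := Finset.le_card_sdiff bad (G.neighborFinset v)
      rw [card_neighborFinset_eq_degree] at this
      omega
    obtain ⟨I, hI, hI4⟩ := Finset.exists_subset_card_eq hcard
    let z := I.orderEmbOfFin hI4
    have hz : ∀ i, G.Adj v (z i) ∧ (z i).val + 2 < N ∧ (z i).val + 1 ≠ v.val := by
      intro i
      have h := hI (Finset.orderEmbOfFin_mem I hI4 i)
      simp only [bad, Finset.mem_sdiff, mem_neighborFinset, Finset.mem_filter, Finset.mem_univ,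
        true_and, Finset.mem_insert, Finset.mem_singleton, not_or] at h
      refine ⟨h.1, ?_, ?_⟩ <;> simp only [z] <;> omega
    have inj : ∀ i j, (z i).val = (z j).val → i = j := fun i j h => z.injective (Fin.ext h)
    refine not_exists_four_disjoint_paths col hP hC (v := v) z
      (fun i => ⟨(z i).val + 1, by have := hz i; omega⟩)
      (fun i => ⟨(z i).val + 2, (hz i).2.1⟩) z.injective ?_ ?_ (fun i => (hz i).1)
      (fun i => hG _ _ rfl) (fun i => hG _ _ rfl) (fun i h => (hz i).2.2 (congrArg Fin.val h)) ?_
    · intro i j h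
      exact inj i j (by simpa using h)
    · intro i j h
      exact inj i j (by simpa using h)
    · intro i h
      have := congrArg Fin.val h
      simp at this
  simpa using conn.card_le_pow deg (conn.dist_le_five hP)

/-- Paths in a `(P₇, C₄)`-free bipartite graph have bounded length. -/
theorem length_le_of_isChain (hG : G.IsBipartite) (hP : ¬ pathGraph 7 ⊴ G)
    (hC : ¬ cycleGraph 4 ⊴ G) {l : List V} (hl : l.Nodup) (hc : l.IsChain G.Adj) :
    l.length ≤ 7 ^ 5 := by
  obtain ⟨col⟩ := hG
  let e : G.comap l.get ↪g G := Embedding.comap ⟨l.get, List.nodup_iff_injective_get.1 hl⟩ G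
  refine card_le_of_hamiltonian_path (G := G.comap l.get) (col.comp e.toHom)
    (fun h => hP (h.trans ⟨e⟩)) (fun h => hC (h.trans ⟨e⟩)) ?_
  intro i j hij
  have := List.isChain_iff_getElem.1 hc i.val (by omega)
  simpa [hij] using this

end SimpleGraph

/-! ### Conclusion -/

theorem exists_hasTreeDepthLE_of_mem_p7c4FreeBipartite :
    ∃ n, ∀ G ∈ p7c4FreeBipartite.{u}, HasTreeDepthLE G.graph n Set.univ := by
  obtain ⟨n, hn⟩ : ∃ n, n = 7 ^ 5 := ⟨_, rfl⟩
  refine ⟨n, fun G hG => hasTreeDepthLE_of_path_length_le G.graph n _ (fun _ => True)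
    (fun v _ => ⟨v, Set.mem_univ v, trivial, SimpleGraph.Reachable.refl v⟩) ?_⟩
  intro _ _ _ _ hl hc
  rw [hn]
  exact SimpleGraph.length_le_of_isChain hG.1 hG.2.1 hG.2.2 hl hc

/-- A finite nonempty graph with trivial labels. -/
def FinGraph.toLabelledPart (G : FinGraph.{u}) [Nonempty G.V] : LabelledPart.{u} Unit where
  V := G.V
  graph := G.graph
  label _ := ()
  carrier := Set.univ
  finite := haveI := G.finite; Set.finite_univ

theorem FinGraph.le_of_embeds {G H : FinGraph.{u}} [Nonempty G.V] [Nonempty H.V]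
    (h : G.toLabelledPart.Embeds H.toLabelledPart) : G ≤ H := by
  obtain ⟨f, -, hi, -, ha⟩ := h
  exact ⟨⟨⟨f, Set.injOn_univ.1 hi⟩, fun {v w} => ha v (Set.mem_univ v) w (Set.mem_univ w)⟩⟩

theorem mainTheorem4 :
    WellQuasiOrdered (fun G H : p7c4FreeBipartite.{u} => G.1 ≤ H.1) := by
  intro G
  -- `LabelledPart` needs a nonempty vertex type; an empty graph embeds in its successor.
  by_cases hne : ∀ i, Nonempty (G i).1.V
  · obtain ⟨n, hn⟩ := exists_hasTreeDepthLE_of_mem_p7c4FreeBipartite.{u}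
    have wqo := LabelledPart.partiallyWellOrderedOn_hasTreeDepthLE.{u} n Unit
    rw [Set.partiallyWellOrderedOn_iff_exists_lt] at wqo
    obtain ⟨i, j, hij, h⟩ := wqo (fun i => (G i).1.toLabelledPart)
      fun i => hn _ (G i).2
    exact ⟨i, j, hij, FinGraph.le_of_embeds h⟩
  · push Not at hne
    obtain ⟨i, hi⟩ := hne
    exact ⟨i, i + 1, i.lt_succ_self, SimpleGraph.IsIndContained.of_isEmpty⟩
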